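/- Let $N\ge 2$ and $1<p<\infty$, and let $\Omega\subset\mathbb R^N$ be a bounded domain (nonempty, open, connected) of class $C^2$. Let $u\in C^1(\overline\Omega)$ be a solution of the $p$-torsion problem $$-\Delta_p u=-\operatorname{div}\big(|\nabla u|^{p-2}\nabla u\big)=1\ \text{ in }\Omega,\qquad u=0\ \text{ on }\partial\Omega,$$ that is, $u=0$ on $\partial\Omega$ and $\int_\Omega|\nabla u|^{p-2}\langle\nabla u,\nabla\varphi\rangle\,dx=\int_\Omega\varphi\,dx$ for every $\varphi\in C_c^\infty(\Omega)$. Let $\rho_i$ be the optimal interior radius of $\Omega$, i.e. the supremum of the radii $r>0$ such that for every $x_0\in\partial\Omega$ there is an open ball $B_r(c)\subset\Omega$ with $x_0\in\partial B_r(c)$. Let $\rho_e\in(0,\infty]$ be the optimal exterior radius of $\Omega$, i.e. the supremum of the radii $r>0$ such that for every $x_0\in\partial\Omega$ there is an open ball $B_r(c)\subset\mathbb R^N\setminus\overline\Omega$ with $x_0\in\partial B_r(c)$. Then $0<\rho_i<\infty$, $\rho_e>0$, and $$\left(\frac{\rho_i}{N}\right)^{\frac1{p-1}}\le|\nabla u|\le\left[\frac{(\operatorname{diam}(\Omega)+\rho_e)^N}{N\rho_e^{N-1}}-\frac{\rho_e}{N}\right]^{\frac1{p-1}}\quad\text{on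 }\partial\Omega,$$ where $\nabla u$ on $\partial\Omega$ is the continuous extension of $\nabla u$ from $\Omega$, and where, if $\rho_e=\infty$ (for instance if $\Omega$ is convex), the bracket stands for its limit $\operatorname{diam}(\Omega)$ as $\rho_e\to\infty$. -/

import Mathlib

open MeasureTheory Set
open scoped Gradient ENNReal ContDiff RealInnerProductSpace

noncomputable section

/-- `Ω` is a bounded domain of class `C²` in `ℝᴺ`: a bounded, nonempty, connected open set such
that near each boundary point `x₀` it is the sublevel set `{φ < 0}` of a `C²` function `φ`
with `∇φ(x₀) ≠ 0` (so that `Ω` lies locally on one side of the `C²` hypersurface `∂Ω`). -/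
structure IsBoundedC2Domain {N : ℕ} (Ω : Set (EuclideanSpace ℝ (Fin N))) : Prop where
  isOpen : IsOpen Ω
  isConnected : IsConnected Ω
  isBounded : Bornology.IsBounded Ω
  regular_boundary : ∀ x₀ ∈ frontier Ω,
    ∃ (U : Set (EuclideanSpace ℝ (Fin N))) (φ : EuclideanSpace ℝ (Fin N) → ℝ),
      IsOpen U ∧ x₀ ∈ U ∧ ContDiffOn ℝ 2 φ U ∧ ∇ φ x₀ ≠ 0 ∧ Ω ∩ U = {x ∈ U | φ x < 0}

/-- `u ∈ C¹(Ω̄)` (`Ω` open): `u` is `C¹` in `Ω`, it is continuous on `Ω̄`, and its gradient has a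
continuous extension from `Ω` to `Ω̄`. -/
structure IsC1UpToBoundary {N : ℕ} (Ω : Set (EuclideanSpace ℝ (Fin N)))
    (u : EuclideanSpace ℝ (Fin N) → ℝ) : Prop where
  contDiffOn : ContDiffOn ℝ 1 u Ω
  continuousOn : ContinuousOn u (closure Ω)
  exists_extension : ∃ G : EuclideanSpace ℝ (Fin N) → EuclideanSpace ℝ (Fin N),
    ContinuousOn G (closure Ω) ∧ ∀ x ∈ Ω, G x = ∇ u x

/-- The gradient of `u` on `Ω̄`: at `x` it is the limit of `∇u(y)` as `y → x` with `y ∈ Ω`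
(which exists for `x ∈ Ω̄` when `u ∈ C¹(Ω̄)`). -/
def closureGradient {N : ℕ} (Ω : Set (EuclideanSpace ℝ (Fin N)))
    (u : EuclideanSpace ℝ (Fin N) → ℝ) :
    EuclideanSpace ℝ (Fin N) → EuclideanSpace ℝ (Fin N) :=
  extendFrom Ω (∇ u)

/-- `u` solves the `p`-torsion problem `-Δ_p u = 1` in `Ω`, `u = 0` on `∂Ω`, for a function `u`
which is `C¹` in `Ω` and continuous on `Ω̄`. The equation holds in the weak sense,
`∫_Ω |∇u|^{p-2} ∇u · ∇φ = ∫_Ω φ` for every `φ ∈ C_c^∞(Ω)`, and the boundary condition pointwise.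
(Where `∇u = 0`, the field `|∇u|^{p-2} ∇u` is `0`.) -/
structure SolvesPTorsion {N : ℕ} (p : ℝ) (Ω : Set (EuclideanSpace ℝ (Fin N)))
    (u : EuclideanSpace ℝ (Fin N) → ℝ) : Prop where
  weak_eq : ∀ φ : EuclideanSpace ℝ (Fin N) → ℝ,
    ContDiff ℝ ∞ φ → HasCompactSupport φ → tsupport φ ⊆ Ω →
      ∫ x in Ω, ⟪‖∇ u x‖ ^ (p - 2) • ∇ u x, ∇ φ x⟫ = ∫ x in Ω, φ x
  boundary_eq : ∀ x ∈ frontier Ω, u x = 0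

/-- The radii `r > 0` such that every boundary point of `Ω` is touched by a ball of radius `r`
contained in `Ω`. -/
def interiorTouchingRadii {N : ℕ} (Ω : Set (EuclideanSpace ℝ (Fin N))) : Set ℝ :=
  {r | 0 < r ∧ ∀ x₀ ∈ frontier Ω, ∃ c, Metric.ball c r ⊆ Ω ∧ x₀ ∈ Metric.sphere c r}

/-- The radii `r > 0` such that every boundary point of `Ω` is touched by a ball of radius `r`
contained in `ℝᴺ \ Ω̄`. -/
def exteriorTouchingRadii {N : ℕ} (Ω : Set (EuclideanSpace ℝ (Fin N))) : Set ℝ :=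
  {r | 0 < r ∧ ∀ x₀ ∈ frontier Ω, ∃ c, Metric.ball c r ⊆ (closure Ω)ᶜ ∧ x₀ ∈ Metric.sphere c r}

/-- The optimal interior radius `ρ_i`, i.e. the largest radius of uniformly touching interior
balls. -/
def optimalInteriorRadius {N : ℕ} (Ω : Set (EuclideanSpace ℝ (Fin N))) : ℝ :=
  sSup (interiorTouchingRadii Ω)

/-- The optimal exterior radius `ρ_e`, i.e. the largest radius of uniformly touching exterior
balls. It is `∞` if there are such balls of arbitrarily large radius, e.g. if `Ω` is convex. -/
def optimalExteriorRadius {N : ℕ} (Ω : Set (EuclideanSpace ℝ (Fin N))) : ℝ≥0∞ :=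
  ⨆ r ∈ exteriorTouchingRadii Ω, ENNReal.ofReal r

/-- The quantity `(d + ρ)^N / (N ρ^{N-1}) - ρ / N`, with its limit `d` (as `ρ → ∞`)
for `ρ = ∞`. -/
def annulusConstant (N : ℕ) (d : ℝ) (ρ : ℝ≥0∞) : ℝ :=
  if ρ = ⊤ then d
  else (d + ρ.toReal) ^ N / (N * ρ.toReal ^ (N - 1)) - ρ.toReal / N

end

/-! The proof uses radial barriers. If a field `a(x) (x - c)` has divergence `-1`, and `w` is a
potential whose gradient is its image under the conjugate power field, then `|∇w|^{p-2} ∇w = a(x) (x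
- c)`, so `w` solves `-Δ_p w = 1` with no second derivatives involved. The choice `a = -1/N` gives
the torsion function of a ball; `a = (R^N |x - c|^{-N} - 1)/N` gives a solution on an annulus, zero
on the inner sphere and with zero gradient on the outer one.

Fix `x₀ ∈ ∂Ω`. On an interior touching ball of radius `r`, comparison (`pLaplace_comparison`) puts
the ball barrier below `u`. For an exterior ball of radius `r` and `R = diam Ω + r`, the annulus
contains the closure of `Ω` and its barrier lies above `u`. All three functions vanish at `x₀`, so
their one-sided derivatives there are ordered, and the barrier gradients are explicit. The lower
bound needs only the direction towards the ball's centre; the upper bound uses all directions of a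
half-space (`norm_le_of_inner_bounds_halfspace`).

The `C²` hypothesis supplies touching balls of uniform radius by a Taylor estimate and compactness.
Bounds for every admissible radius then pass to the optimal radii. -/

noncomputable section

/-! ### The power field and its strict monotonicity -/

section PField

variable {E : Type*} [NormedAddCommGroup E] [InnerProductSpace ℝ E]

/-- The vector field `z ↦ |z|^{p-2} z` underlying the `p`-Laplacian. -/
def pField (p : ℝ) (z : E) : E := ‖z‖ ^ (p - 2) • z

lemma rpow_sub_two_mul_self {p t : ℝ} (hp : 1 < p) (ht : 0 ≤ t) :
    t ^ (p - 2) * t = t ^ (p - 1) := by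
  rcases ht.eq_or_lt with rfl | ht
  · rw [mul_zero, Real.zero_rpow (by linarith)]
  · rw [show p - 1 = (p - 2) + 1 by ring, Real.rpow_add_one ht.ne']

lemma norm_pField {p : ℝ} (hp : 1 < p) (z : E) : ‖pField p z‖ = ‖z‖ ^ (p - 1) := by
  rw [pField, norm_smul, Real.norm_of_nonneg (by positivity),
    rpow_sub_two_mul_self hp (norm_nonneg z)]

/-- The field is `1/p` times the gradient of `|z|^p`, which is `C¹` for `p > 1`; the singular factor
at the origin when `p < 2` thus needs no separate treatment. -/
lemma continuous_pField [CompleteSpace E] {p : ℝ} (hp : 1 < p) :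
    Continuous (pField p : E → E) := by
  have h := (contDiff_norm_rpow (E := E) hp).continuous_fderiv one_ne_zero
  have h2 : (pField p : E → E) =
      fun x => p⁻¹ • (InnerProductSpace.toDual ℝ E).symm (fderiv ℝ (fun x : E => ‖x‖ ^ p) x) := by
    ext1 x
    apply (InnerProductSpace.toDual ℝ E).injective
    rw [map_smul, LinearIsometryEquiv.apply_symm_apply, fderiv_norm_rpow x hp, pField, map_smul,
      smul_smul, ← mul_assoc, inv_mul_cancel₀ (by linarith), one_mul]
    rfl
  rw [h2]
  exact continuous_const.smul ((InnerProductSpace.toDual ℝ E).symm.continuous.comp h)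

/-- This splitting gives strict monotonicity for all `p > 1` at once: the first term is nonnegative
because powers increase, the second by Cauchy-Schwarz. If both vanish, the norms agree and
Cauchy-Schwarz is an equality, whence `a = b`. -/
lemma inner_pField_sub {p : ℝ} (hp : 1 < p) (a b : E) :
    ⟪pField p a - pField p b, a - b⟫ =
      (‖a‖ ^ (p - 1) - ‖b‖ ^ (p - 1)) * (‖a‖ - ‖b‖) +
        (‖a‖ ^ (p - 2) + ‖b‖ ^ (p - 2)) * (‖a‖ * ‖b‖ - ⟪a, b⟫) := by
  rw [← rpow_sub_two_mul_self hp (norm_nonneg a), ← rpow_sub_two_mul_self hp (norm_nonneg b)]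
  simp only [pField, inner_sub_left, inner_sub_right, real_inner_smul_left,
    real_inner_self_eq_norm_sq, real_inner_comm a b]
  ring

lemma sub_mul_sub_rpow_nonneg {p s t : ℝ} (hp : 1 < p) (hs : 0 ≤ s) (ht : 0 ≤ t) :
    0 ≤ (s ^ (p - 1) - t ^ (p - 1)) * (s - t) := by
  rcases le_total s t with h | h
  · exact mul_nonneg_of_nonpos_of_nonpos
      (sub_nonpos.2 (Real.rpow_le_rpow hs h (by linarith))) (sub_nonpos.2 h)
  · exact mul_nonneg (sub_nonneg.2 (Real.rpow_le_rpow ht h (by linarith))) (sub_nonneg.2 h)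

lemma inner_pField_sub_nonneg {p : ℝ} (hp : 1 < p) (a b : E) :
    0 ≤ ⟪pField p a - pField p b, a - b⟫ := by
  rw [inner_pField_sub hp]
  have h1 := sub_mul_sub_rpow_nonneg hp (norm_nonneg a) (norm_nonneg b)
  have h2 := sub_nonneg.2 (real_inner_le_norm a b)
  positivity

lemma eq_of_inner_pField_sub_eq_zero {p : ℝ} (hp : 1 < p) {a b : E}
    (h : ⟪pField p a - pField p b, a - b⟫ = 0) : a = b := by
  rw [inner_pField_sub hp] at h
  have h1 := sub_mul_sub_rpow_nonneg hp (norm_nonneg a) (norm_nonneg b)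
  have h2 := sub_nonneg.2 (real_inner_le_norm a b)
  have h3 : 0 ≤ (‖a‖ ^ (p - 2) + ‖b‖ ^ (p - 2)) * (‖a‖ * ‖b‖ - ⟪a, b⟫) := by positivity
  have hab : ‖a‖ = ‖b‖ := by
    rcases mul_eq_zero.1 (le_antisymm (by linarith) h1) with h4 | h4
    · exact (Real.rpow_left_inj (norm_nonneg a) (norm_nonneg b) (by linarith)).1
        (sub_eq_zero.1 h4)
    · exact sub_eq_zero.1 h4
  rcases eq_or_ne a 0 with rfl | ha
  · rw [norm_zero] at hab
    exact (norm_eq_zero.1 hab.symm).symm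
  · have h5 : 0 < ‖a‖ ^ (p - 2) + ‖b‖ ^ (p - 2) := by
      have := norm_pos_iff.2 ha
      positivity
    have h6 : ‖a‖ * ‖b‖ - ⟪a, b⟫ = 0 :=
      (mul_eq_zero.1 (le_antisymm (by linarith) h3)).resolve_left h5.ne'
    have h7 : ‖a - b‖ ^ 2 = 0 := by
      rw [norm_sub_sq_real, ← sub_eq_zero.1 h6, hab]
      ring
    exact sub_eq_zero.1 (norm_eq_zero.1 (pow_eq_zero_iff two_ne_zero |>.1 h7))

/-- The inverse of `z ↦ |z|^{p-2} z` is the field of the conjugate exponent. -/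
lemma pField_pField_conj {p : ℝ} (hp : 1 < p) (z : E) :
    pField p (pField (1 / (p - 1) + 1) z) = z := by
  have hp' : 0 < p - 1 := by linarith
  have hq : 1 < 1 / (p - 1) + 1 := by
    have : 0 < 1 / (p - 1) := by positivity
    linarith
  rcases eq_or_ne z 0 with rfl | hz
  · simp [pField]
  rw [pField, norm_pField hq, pField, smul_smul, ← Real.rpow_mul (norm_nonneg z),
    ← Real.rpow_add (norm_pos_iff.2 hz)]
  have : (1 / (p - 1) + 1 - 1) * (p - 2) + (1 / (p - 1) + 1 - 2) = 0 := by
    field_simp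
    ring
  rw [this, Real.rpow_zero, one_smul]

end PField

/-! ### Weak divergence identities and `C¹` test functions -/

section TestFunctions

variable {E : Type*} [NormedAddCommGroup E] [InnerProductSpace ℝ E] [FiniteDimensional ℝ E]

lemma ContDiff.continuous_gradient {f : E → ℝ} (hf : ContDiff ℝ 1 f) : Continuous (∇ f) :=
  (InnerProductSpace.toDual ℝ E).symm.continuous.comp (hf.continuous_fderiv one_ne_zero)

lemma ContDiffOn.continuousOn_gradient {f : E → ℝ} {D : Set E} (hD : IsOpen D)
    (hf : ContDiffOn ℝ 1 f D) : ContinuousOn (∇ f) D :=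
  (InnerProductSpace.toDual ℝ E).symm.continuous.comp_continuousOn
    (hf.continuousOn_fderiv_of_isOpen hD le_rfl)

lemma support_gradient_subset (f : E → ℝ) : Function.support (∇ f) ⊆ tsupport f := by
  intro x hx
  refine support_fderiv_subset ℝ (f := f) fun h => hx ?_
  rw [gradient, h, map_zero]

lemma gradient_eq_zero_of_notMem_tsupport {f : E → ℝ} {x : E} (hx : x ∉ tsupport f) :
    ∇ f x = 0 :=
  Function.notMem_support.1 fun h => hx (support_gradient_subset f h)

lemma continuous_inner_gradient {D : Set E} (hD : IsOpen D) {H : E → E} (hH : ContinuousOn H D)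
    {φ : E → ℝ} (hφ : ContDiff ℝ 1 φ) (hsupp : tsupport φ ⊆ D) :
    Continuous fun x => ⟪H x, ∇ φ x⟫ := by
  refine continuous_iff_continuousAt.2 fun x => ?_
  by_cases hx : x ∈ tsupport φ
  · exact (hH.continuousAt (hD.mem_nhds (hsupp hx))).inner hφ.continuous_gradient.continuousAt
  · have : (fun x => ⟪H x, ∇ φ x⟫) =ᶠ[nhds x] fun _ => 0 := by
      filter_upwards [(isClosed_tsupport φ).isOpen_compl.mem_nhds hx] with y hy
      rw [gradient_eq_zero_of_notMem_tsupport hy, inner_zero_right]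
    exact continuousAt_const.congr this.symm

variable [MeasurableSpace E] [BorelSpace E]

lemma integrable_inner_gradient {D : Set E} (hD : IsOpen D) {H : E → E} (hH : ContinuousOn H D)
    {φ : E → ℝ} (hφ : ContDiff ℝ 1 φ) (hc : HasCompactSupport φ) (hsupp : tsupport φ ⊆ D) :
    Integrable (fun x => ⟪H x, ∇ φ x⟫) := by
  refine (continuous_inner_gradient hD hH hφ hsupp).integrable_of_hasCompactSupport ?_
  refine HasCompactSupport.intro hc fun x hx => ?_
  rw [gradient_eq_zero_of_notMem_tsupport hx, inner_zero_right]

/-- The divergence theorem for the field `ψ(x) (x - c)`. -/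
lemma integral_fderiv_sub_center {ψ : E → ℝ} (hψ : ContDiff ℝ 1 ψ) (hc : HasCompactSupport ψ)
    (c : E) :
    ∫ x, (fderiv ℝ ψ x (x - c) + Module.finrank ℝ E * ψ x) = 0 := by
  set b := stdOrthonormalBasis ℝ E
  have hψc : Continuous ψ := hψ.continuous
  have hI : Integrable ψ := hψc.integrable_of_hasCompactSupport hc
  have hdc : Continuous (fderiv ℝ ψ) := hψ.continuous_fderiv one_ne_zero
  have hterm : ∀ i, Continuous fun x => ⟪b i, x - c⟫ * fderiv ℝ ψ x (b i) := fun i => by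
    fun_prop
  have hint : ∀ i, Integrable fun x => ⟪b i, x - c⟫ * fderiv ℝ ψ x (b i) := fun i => by
    refine (hterm i).integrable_of_hasCompactSupport (HasCompactSupport.intro hc fun x hx => ?_)
    have : fderiv ℝ ψ x = 0 := Function.notMem_support.1 fun h => hx (support_fderiv_subset ℝ h)
    simp [this]
  have hfd : ∀ i x, HasFDerivAt (fun x => ⟪b i, x - c⟫) (innerSL ℝ (b i)) x := fun i x =>
    (innerSL ℝ (b i)).hasFDerivAt.comp x ((hasFDerivAt_id x).sub_const c)
  -- Integrate by parts in each basis direction; the coordinate `⟪b i, x - c⟫` has derivative `1`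
  -- along `b i`.
  have hparts : ∀ i, ∫ x, ⟪b i, x - c⟫ * fderiv ℝ ψ x (b i) = - ∫ x, ψ x := fun i => by
    have hfi : ∀ x, fderiv ℝ (fun x => ⟪b i, x - c⟫) x (b i) = 1 := fun x => by
      rw [(hfd i x).fderiv, innerSL_apply_apply, real_inner_self_eq_norm_sq, b.norm_eq_one]
      norm_num
    rw [integral_mul_fderiv_eq_neg_fderiv_mul_of_integrable (v := b i)]
    · simp only [hfi, one_mul]
    · simpa only [hfi, one_mul] using hI
    · exact hint i
    · exact Continuous.integrable_of_hasCompactSupport (by fun_prop) hc.mul_left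
    · exact fun x _ => (hfd i x).differentiableAt
    · exact fun x _ => hψ.differentiable one_ne_zero x
  have hsum : ∀ x, fderiv ℝ ψ x (x - c) = ∑ i, ⟪b i, x - c⟫ * fderiv ℝ ψ x (b i) := fun x => by
    conv_lhs => rw [← b.sum_repr' (x - c)]
    simp
  simp only [hsum]
  rw [integral_add (integrable_finsetSum _ fun i _ => hint i) (hI.const_mul _),
    integral_finsetSum _ fun i _ => hint i]
  simp only [hparts]
  rw [integral_const_mul]
  simp

/-- If `N a + Da(x)(x - c) = -1`, the field `a(x) (x - c)` has divergence `-1`. -/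
lemma integral_inner_radial {D : Set E} (hD : IsOpen D) {a : E → ℝ} (ha : ContDiffOn ℝ 1 a D)
    {c : E} (hdiv : ∀ x ∈ D, Module.finrank ℝ E * a x + fderiv ℝ a x (x - c) = -1)
    {φ : E → ℝ} (hφ : ContDiff ℝ 1 φ) (hc : HasCompactSupport φ) (hsupp : tsupport φ ⊆ D) :
    ∫ x, ⟪a x • (x - c), ∇ φ x⟫ = ∫ x, φ x := by
  -- The product is globally `C¹` although `a` is regular only on `D`, since `φ` vanishes near every
  -- point off its support.
  have hψ : ContDiff ℝ 1 fun x => φ x * a x := by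
    refine contDiff_iff_contDiffAt.2 fun x => ?_
    by_cases hx : x ∈ tsupport φ
    · exact hφ.contDiffAt.mul (ha.contDiffAt (hD.mem_nhds (hsupp hx)))
    · refine (contDiffAt_const (c := (0 : ℝ))).congr_of_eventuallyEq ?_
      filter_upwards [(isClosed_tsupport φ).isOpen_compl.mem_nhds hx] with y hy
      rw [image_eq_zero_of_notMem_tsupport hy, zero_mul]
  have h0 := integral_fderiv_sub_center hψ (hc.mul_right (f' := a)) c
  have hH : ContinuousOn (fun x => a x • (x - c)) D :=
    ha.continuousOn.smul (continuousOn_id.sub continuousOn_const)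
  have hI := integrable_inner_gradient hD hH hφ hc hsupp
  have hφI : Integrable φ := hφ.continuous.integrable_of_hasCompactSupport hc
  rw [← sub_eq_zero, ← integral_sub hI hφI, ← h0]
  congr 1
  ext x
  by_cases hx : x ∈ tsupport φ
  · have hda := (ha.contDiffAt (hD.mem_nhds (hsupp hx))).differentiableAt one_ne_zero
    have h := (hφ.differentiable one_ne_zero x).hasFDerivAt.mul hda.hasFDerivAt
    have h1 := hdiv x (hsupp hx)
    rw [show (fun x => φ x * a x) = φ * a from rfl, h.fderiv, real_inner_smul_left, real_inner_comm, inner_gradient_left]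
    simp only [add_apply, smul_apply, smul_eq_mul]
    linear_combination -(φ x) * h1
  · have h1 : fderiv ℝ (fun x => φ x * a x) x = 0 := Function.notMem_support.1 fun h =>
      hx (tsupport_mul_subset_left (support_fderiv_subset ℝ h))
    rw [gradient_eq_zero_of_notMem_tsupport hx, h1, image_eq_zero_of_notMem_tsupport hx]
    simp

/-- Uniform `C¹` approximation of compactly supported `C¹` functions by smooth ones. -/
lemma exists_smooth_approx {φ : E → ℝ} (hφ : ContDiff ℝ 1 φ) (hc : HasCompactSupport φ)
    {δ ε : ℝ} (hδ : 0 < δ) (hε : 0 < ε) :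
    ∃ ψ : E → ℝ, ContDiff ℝ ∞ ψ ∧ Function.support ψ ⊆ Metric.cthickening δ (tsupport φ) ∧
      (∀ x, |ψ x - φ x| ≤ ε) ∧ ∀ x, ‖∇ ψ x - ∇ φ x‖ ≤ ε := by
  have hdc : Continuous (fderiv ℝ φ) := hφ.continuous_fderiv one_ne_zero
  obtain ⟨δ₁, hδ₁, h1⟩ := Metric.uniformContinuous_iff.1
    (hc.uniformContinuous_of_continuous hφ.continuous) ε hε
  obtain ⟨δ₂, hδ₂, h2⟩ := Metric.uniformContinuous_iff.1
    ((hc.fderiv ℝ).uniformContinuous_of_continuous hdc) ε hε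
  -- The mollification radius respects the allowed support enlargement and the moduli of uniform
  -- continuity of `φ` and its derivative.
  set η := min δ (min δ₁ δ₂)
  have hη : 0 < η := lt_min hδ (lt_min hδ₁ hδ₂)
  let f : ContDiffBump (0 : E) := ⟨η / 2, η, by positivity, by linarith⟩
  have hf : LocallyIntegrable (f.normed volume) :=
    (f.continuous_normed (μ := volume)).locallyIntegrable
  have hder : ∀ x, HasFDerivAt
      (convolution (f.normed volume) φ (ContinuousLinearMap.lsmul ℝ ℝ) volume)
      (convolution (f.normed volume) (fderiv ℝ φ) (ContinuousLinearMap.lsmul ℝ ℝ) volume x) x :=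
    fun x => hc.hasFDerivAt_convolution_right _ hf hφ x
  refine ⟨convolution (f.normed volume) φ (ContinuousLinearMap.lsmul ℝ ℝ) volume, ?_, ?_, ?_, ?_⟩
  · exact f.hasCompactSupport_normed.contDiff_convolution_left _ f.contDiff_normed
      hφ.continuous.locallyIntegrable
  · refine (support_convolution_subset _).trans ?_
    rw [f.support_normed_eq]
    rintro _ ⟨y, hy, z, hz, rfl⟩
    refine Metric.mem_cthickening_of_dist_le _ z _ _ (subset_tsupport φ hz) ?_
    have : ‖y‖ < η := by simpa [f] using hy
    simpa using this.le.trans (min_le_left _ _)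
  · intro x
    rw [← Real.dist_eq]
    refine f.dist_normed_convolution_le hφ.continuous.aestronglyMeasurable fun y hy => ?_
    refine (h1 ?_).le
    exact lt_of_lt_of_le (Metric.mem_ball.1 hy) ((min_le_right _ _).trans (min_le_left _ _))
  · intro x
    rw [gradient, gradient, (hder x).fderiv, ← map_sub, LinearIsometryEquiv.norm_map,
      ← dist_eq_norm]
    refine f.dist_normed_convolution_le hdc.aestronglyMeasurable fun y hy => ?_
    refine (h2 ?_).le
    exact lt_of_lt_of_le (Metric.mem_ball.1 hy) ((min_le_right _ _).trans (min_le_right _ _))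

/-- A weak equation tested by smooth functions may be tested by `C¹` functions. -/
lemma weak_eq_of_contDiff_one {D : Set E} (hD : IsOpen D) {H : E → E} (hH : ContinuousOn H D)
    (hweak : ∀ φ : E → ℝ, ContDiff ℝ ∞ φ → HasCompactSupport φ → tsupport φ ⊆ D →
      ∫ x, ⟪H x, ∇ φ x⟫ = ∫ x, φ x)
    {φ : E → ℝ} (hφ : ContDiff ℝ 1 φ) (hc : HasCompactSupport φ) (hsupp : tsupport φ ⊆ D) :
    ∫ x, ⟪H x, ∇ φ x⟫ = ∫ x, φ x := by
  obtain ⟨δ, hδ, hK⟩ := hc.isCompact.exists_cthickening_subset_open hD hsupp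
  set K := Metric.cthickening δ (tsupport φ)
  have hKc : IsCompact K := hc.isCompact.cthickening
  have hφK : tsupport φ ⊆ K := Metric.self_subset_cthickening _
  have hIK : IntegrableOn (fun x => ‖H x‖ + 1) K :=
    ((hH.mono hK).norm.add continuousOn_const).integrableOn_compact hKc
  set M := ∫ x in K, (‖H x‖ + 1)
  have hM : 0 ≤ M := integral_nonneg fun x => by positivity
  refine sub_eq_zero.1 (abs_eq_zero.1 (le_antisymm (le_of_forall_pos_le_add fun ε hε => ?_)
    (abs_nonneg _)))
  -- With `C¹` error `ε / (M + 1)`, the total error is at most `ε M / (M + 1)`: in the weight `‖H‖ +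
  -- 1`, the `1` pays for `ψ - φ` and `‖H‖` for the gradients.
  obtain ⟨ψ, hψ, hψK, h1, h2⟩ := exists_smooth_approx hφ hc hδ
    (show 0 < ε / (M + 1) by positivity)
  have hψK' : tsupport ψ ⊆ K := closure_minimal hψK Metric.isClosed_cthickening
  have hψc : HasCompactSupport ψ := hKc.of_isClosed_subset (isClosed_tsupport _) hψK'
  have hψ1 : ContDiff ℝ 1 ψ := hψ.of_le (by exact_mod_cast le_top)
  have e := hweak ψ hψ hψc (hψK'.trans hK)
  have i1 := integrable_inner_gradient hD hH hφ hc hsupp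
  have i2 := integrable_inner_gradient hD hH hψ1 hψc (hψK'.trans hK)
  have i3 : Integrable φ := hφ.continuous.integrable_of_hasCompactSupport hc
  have i4 : Integrable ψ := hψ1.continuous.integrable_of_hasCompactSupport hψc
  have key : (∫ x, ⟪H x, ∇ φ x⟫) - ∫ x, φ x =
      ∫ x in K, ((⟪H x, ∇ φ x⟫ - φ x) - (⟪H x, ∇ ψ x⟫ - ψ x)) := by
    have i13 : Integrable fun x => ⟪H x, ∇ φ x⟫ - φ x := i1.sub i3
    have i24 : Integrable fun x => ⟪H x, ∇ ψ x⟫ - ψ x := i2.sub i4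
    rw [setIntegral_eq_integral_of_forall_compl_eq_zero, integral_sub i13 i24,
      integral_sub i1 i3, integral_sub i2 i4, e]
    · ring
    · intro x hx
      rw [gradient_eq_zero_of_notMem_tsupport fun h => hx (hφK h),
        gradient_eq_zero_of_notMem_tsupport fun h => hx (hψK' h),
        image_eq_zero_of_notMem_tsupport fun h => hx (hφK h),
        image_eq_zero_of_notMem_tsupport fun h => hx (hψK' h)]
      simp
  rw [key, zero_add, ← Real.norm_eq_abs]
  calc _ ≤ ∫ x in K, (ε / (M + 1)) * (‖H x‖ + 1) := by
        refine norm_integral_le_of_norm_le (hIK.const_mul _) (Filter.Eventually.of_forall ?_)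
        intro x
        have e1 : (⟪H x, ∇ φ x⟫ - φ x) - (⟪H x, ∇ ψ x⟫ - ψ x) =
            (ψ x - φ x) - ⟪H x, ∇ ψ x - ∇ φ x⟫ := by
          rw [inner_sub_right]
          ring
        rw [e1]
        calc _ ≤ ‖ψ x - φ x‖ + ‖⟪H x, ∇ ψ x - ∇ φ x⟫‖ := norm_sub_le _ _
          _ ≤ ε / (M + 1) + ‖H x‖ * (ε / (M + 1)) :=
            add_le_add (h1 x) ((norm_inner_le_norm _ _).trans
              (mul_le_mul_of_nonneg_left (h2 x) (norm_nonneg _)))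
          _ = _ := by ring
    _ = (ε / (M + 1)) * M := integral_const_mul _ _
    _ ≤ ε := by
        rw [div_mul_eq_mul_div, div_le_iff₀ (by positivity)]
        nlinarith

end TestFunctions

/-! ### Weak comparison principle -/

section Comparison

/-- Squaring the positive part makes it `C¹`, so comparison can be tested without Sobolev functions.
-/
lemma hasDerivAt_max_zero_sq (t : ℝ) :
    HasDerivAt (fun t : ℝ => max t 0 ^ 2) (2 * max t 0) t := by
  rcases lt_trichotomy t 0 with h | rfl | h
  · rw [max_eq_right h.le, mul_zero]
    refine (hasDerivAt_const t (0 : ℝ)).congr_of_eventuallyEq ?_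
    filter_upwards [Iio_mem_nhds h] with s hs
    simp [max_eq_right (mem_Iio.1 hs).le]
  · simp only [max_self, mul_zero]
    refine hasDerivAt_iff_isLittleO.2 ?_
    refine Asymptotics.IsLittleO.of_bound fun c hc => ?_
    filter_upwards [Metric.ball_mem_nhds (0 : ℝ) hc] with s hs
    have h1 : |max s 0| ≤ |s| := by
      rcases le_total s 0 with h | h <;> simp [h]
    have h2 : |s| < c := by simpa using hs
    have h3 : |max s 0| ^ 2 ≤ |s| ^ 2 := pow_le_pow_left₀ (abs_nonneg _) h1 2
    simp only [max_self, sub_zero, smul_zero, ne_eq, OfNat.ofNat_ne_zero, not_false_eq_true,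
      zero_pow, Real.norm_eq_abs, abs_pow]
    nlinarith [abs_nonneg s]
  · rw [max_eq_left h.le]
    have := hasDerivAt_pow 2 t
    simp only [Nat.cast_ofNat, Nat.add_one_sub_one, pow_one] at this
    refine this.congr_of_eventuallyEq ?_
    filter_upwards [Ioi_mem_nhds h] with s hs
    simp [max_eq_left (mem_Ioi.1 hs).le]

lemma contDiff_max_zero_sq : ContDiff ℝ 1 fun t : ℝ => max t 0 ^ 2 := by
  rw [contDiff_one_iff_deriv]
  refine ⟨fun t => (hasDerivAt_max_zero_sq t).differentiableAt, ?_⟩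
  rw [show deriv (fun t : ℝ => max t 0 ^ 2) = fun t => 2 * max t 0 from
    funext fun t => (hasDerivAt_max_zero_sq t).deriv]
  fun_prop

variable {E : Type*} [NormedAddCommGroup E] [InnerProductSpace ℝ E] [FiniteDimensional ℝ E]
  [MeasurableSpace E] [BorelSpace E]

/-- The weak comparison principle for the `p`-Laplacian on a bounded open set. -/
theorem pLaplace_comparison [Nontrivial E] {p : ℝ} (hp : 1 < p) {D : Set E} (hD : IsOpen D)
    (hDb : Bornology.IsBounded D) {v w : E → ℝ} (hv : ContDiffOn ℝ 1 v D)
    (hw : ContDiffOn ℝ 1 w D) (hvc : ContinuousOn v (closure D))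
    (hwc : ContinuousOn w (closure D)) (hbd : ∀ x ∈ frontier D, v x ≤ w x)
    (hweak : ∀ φ : E → ℝ, ContDiff ℝ 1 φ → HasCompactSupport φ → tsupport φ ⊆ D →
      (∀ x, 0 ≤ φ x) → ∫ x, ⟪pField p (∇ v x), ∇ φ x⟫ ≤ ∫ x, ⟪pField p (∇ w x), ∇ φ x⟫) :
    ∀ x ∈ closure D, v x ≤ w x := by
  classical
  suffices h : ∀ x ∈ D, v x ≤ w x by
    intro x hx
    by_cases hxD : x ∈ D
    · exact h x hxD
    · exact hbd x (by rw [hD.frontier_eq]; exact ⟨hx, hxD⟩)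
  intro x₀ hx₀
  refine le_of_forall_pos_le_add fun ε hε => ?_
  -- Subtracting `ε` makes `d` negative on the boundary, so `{d ≥ 0}` is a compact subset of `D` and
  -- the test function has compact support there.
  set d : E → ℝ := fun x => v x - w x - ε
  have hdC : ContDiffOn ℝ 1 d D := (hv.sub hw).sub contDiffOn_const
  have hdc : ContinuousOn d (closure D) := (hvc.sub hwc).sub continuousOn_const
  set K : Set E := closure D ∩ d ⁻¹' Ici 0
  have hKcl : IsClosed K := hdc.preimage_isClosed_of_isClosed isClosed_closure isClosed_Ici
  have hKc : IsCompact K :=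
    Metric.isCompact_of_isClosed_isBounded hKcl (hDb.closure.subset inter_subset_left)
  have hKD : K ⊆ D := by
    rintro x ⟨hx, hx2⟩
    by_contra hxD
    have h1 := hbd x (by rw [hD.frontier_eq]; exact ⟨hx, hxD⟩)
    have h2 : 0 ≤ v x - w x - ε := hx2
    linarith
  set φ : E → ℝ := fun x => if x ∈ D then max (d x) 0 ^ 2 else 0
  have hφ0 : ∀ x, x ∉ K → φ x = 0 := by
    intro x hx
    by_cases hxD : x ∈ D
    · have h1 : d x < 0 := by
        by_contra h
        exact hx ⟨subset_closure hxD, not_lt.1 h⟩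
      simp [φ, hxD, max_eq_right h1.le]
    · simp [φ, hxD]
  have hφD : ∀ x ∈ D, φ =ᶠ[nhds x] fun y => max (d y) 0 ^ 2 := fun x hx => by
    filter_upwards [hD.mem_nhds hx] with y hy
    simp [φ, hy]
  have hφC : ContDiff ℝ 1 φ := by
    refine contDiff_iff_contDiffAt.2 fun x => ?_
    by_cases hx : x ∈ D
    · exact (contDiff_max_zero_sq.contDiffAt.comp x
        (hdC.contDiffAt (hD.mem_nhds hx))).congr_of_eventuallyEq (hφD x hx)
    · refine (contDiffAt_const (c := (0 : ℝ))).congr_of_eventuallyEq ?_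
      filter_upwards [hKcl.isOpen_compl.mem_nhds fun h => hx (hKD h)] with y hy
      exact hφ0 y hy
  have hφc : HasCompactSupport φ := HasCompactSupport.intro hKc hφ0
  have hφK : tsupport φ ⊆ K :=
    closure_minimal (fun x hx => by_contra fun h => hx (hφ0 x h)) hKcl
  have hsupp := hφK.trans hKD
  have hφpos : ∀ x, 0 ≤ φ x := fun x => by
    simp only [φ]
    split_ifs <;> positivity
  have hgrad : ∀ x ∈ D, ∇ φ x = (2 * max (d x) 0) • (∇ v x - ∇ w x) := by
    intro x hx
    have e1 := ((hv.contDiffAt (hD.mem_nhds hx)).differentiableAt one_ne_zero).hasFDerivAt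
    have e2 := ((hw.contDiffAt (hD.mem_nhds hx)).differentiableAt one_ne_zero).hasFDerivAt
    have e3 : HasFDerivAt d (fderiv ℝ v x - fderiv ℝ w x) x := (e1.sub e2).sub_const ε
    have e4 := (hasDerivAt_max_zero_sq (d x)).comp_hasFDerivAt x e3
    rw [(hφD x hx).gradient_eq]
    simp only [gradient]
    rw [← map_sub, ← LinearIsometryEquiv.map_smul]
    exact congrArg _ e4.fderiv
  have hvH : ContinuousOn (fun x => pField p (∇ v x)) D :=
    (continuous_pField hp).comp_continuousOn (hv.continuousOn_gradient hD)
  have hwH : ContinuousOn (fun x => pField p (∇ w x)) D :=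
    (continuous_pField hp).comp_continuousOn (hw.continuousOn_gradient hD)
  have hle := hweak φ hφC hφc hsupp hφpos
  have iv := integrable_inner_gradient hD hvH hφC hφc hsupp
  have iw := integrable_inner_gradient hD hwH hφC hφc hsupp
  set g : E → ℝ := fun x => ⟪pField p (∇ v x), ∇ φ x⟫ - ⟪pField p (∇ w x), ∇ φ x⟫
  have hgc : Continuous g := (continuous_inner_gradient hD hvH hφC hsupp).sub
    (continuous_inner_gradient hD hwH hφC hsupp)
  have hgD : ∀ x ∈ D, g x =
      (2 * max (d x) 0) * ⟪pField p (∇ v x) - pField p (∇ w x), ∇ v x - ∇ w x⟫ := fun x hx => by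
    simp only [g]
    rw [← inner_sub_left, hgrad x hx, real_inner_smul_right]
  have hg0 : 0 ≤ g := fun x => by
    by_cases hx : x ∈ D
    · rw [hgD x hx]
      have := inner_pField_sub_nonneg hp (∇ v x) (∇ w x)
      simp only [Pi.zero_apply]
      positivity
    · have h0 : ∇ φ x = 0 := gradient_eq_zero_of_notMem_tsupport fun h => hx (hsupp h)
      simp only [g, h0, inner_zero_right, sub_self]
      exact le_rfl
  have hgint : ∫ x, g x = 0 := by
    refine le_antisymm ?_ (integral_nonneg hg0)
    rw [show ∫ x, g x = _ from integral_sub iv iw]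
    linarith
  -- A continuous nonnegative function with zero integral vanishes. Hence at each point of `D`
  -- either `d ≤ 0` or the two gradients agree, and in both cases `∇φ = 0`.
  have hgz : g = 0 := (Continuous.ae_eq_iff_eq volume hgc continuous_const).1
    ((integral_eq_zero_iff_of_nonneg hg0 (iv.sub iw)).1 hgint)
  have hz : ∀ x, fderiv ℝ φ x = 0 := by
    intro x
    have : ∇ φ x = 0 := by
      by_cases hx : x ∈ D
      · have h1 := congrFun hgz x
        rw [hgD x hx, Pi.zero_apply] at h1
        rw [hgrad x hx]
        rcases mul_eq_zero.1 h1 with h2 | h2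
        · rw [h2, zero_smul]
        · rw [eq_of_inner_pField_sub_eq_zero hp h2, sub_self, smul_zero]
      · exact gradient_eq_zero_of_notMem_tsupport fun h => hx (hsupp h)
    rw [← toDual_gradient, this, map_zero]
  -- `φ` is constant on the whole space, which is not compact, so the constant is its value `0` off
  -- `K`.
  obtain ⟨y, hy⟩ : ∃ y, y ∉ K := by
    by_contra! h
    have : K = univ := eq_univ_of_forall h
    have hcs : CompactSpace E := ⟨this ▸ hKc⟩
    exact not_compactSpace_iff.2 (NormedSpace.noncompactSpace ℝ E) hcs
  have h1 := is_const_of_fderiv_eq_zero (hφC.differentiable one_ne_zero) hz x₀ y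
  rw [hφ0 y hy] at h1
  have h2 : max (d x₀) 0 = 0 := by
    have : max (d x₀) 0 ^ 2 = 0 := by simpa [φ, hx₀] using h1
    exact pow_eq_zero_iff two_ne_zero |>.1 this
  have h3 : v x₀ - w x₀ - ε ≤ 0 := h2 ▸ le_max_left (d x₀) 0
  linarith

end Comparison

/-! ### Radial solutions on balls and annuli -/

section Barriers

variable {E : Type*} [NormedAddCommGroup E] [InnerProductSpace ℝ E] [FiniteDimensional ℝ E]

lemma HasDerivAt.hasGradientAt_radial {α : ℝ → ℝ} {α' : ℝ} {c x : E} (hx : x ≠ c)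
    (h : HasDerivAt α α' ‖x - c‖) :
    HasGradientAt (fun y => α ‖y - c‖) ((α' / ‖x - c‖) • (x - c)) x := by
  have hpos : 0 < ‖x - c‖ := norm_pos_iff.2 (sub_ne_zero.2 hx)
  have h1 : HasFDerivAt (fun y => ‖y - c‖ ^ 2) (2 • innerSL ℝ (x - c)) x :=
    (HasFDerivAt.comp (g := fun z : E => ‖z‖ ^ 2) (f := fun y => y - c) x
      (hasStrictFDerivAt_norm_sq (x - c)).hasFDerivAt
      ((hasFDerivAt_id x).sub_const c)).congr_fderiv (by ext; simp)
  have h2 := h1.sqrt (by positivity)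
  have h3 : HasFDerivAt (fun y => ‖y - c‖) ((1 / ‖x - c‖) • innerSL ℝ (x - c)) x := by
    refine (h2.congr_of_eventuallyEq (Filter.Eventually.of_forall fun y => ?_)).congr_fderiv ?_
    · simp
    · ext z
      simp
      field_simp
  rw [hasGradientAt_iff_hasFDerivAt]
  refine (h.comp_hasFDerivAt x h3).congr_fderiv ?_
  ext z
  simp
  ring

lemma contDiffOn_of_hasGradientAt {D : Set E} (hD : IsOpen D) {w : E → ℝ} {g : E → E}
    (hg : ContinuousOn g D) (hw : ∀ x ∈ D, HasGradientAt w (g x) x) : ContDiffOn ℝ 1 w D := by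
  rw [← zero_add (1 : WithTop ℕ∞), contDiffOn_succ_iff_fderiv_of_isOpen hD]
  refine ⟨fun x hx => (hw x hx).differentiableAt.differentiableWithinAt, by simp,
    contDiffOn_zero.2 ?_⟩
  refine ((InnerProductSpace.toDual ℝ E).continuous.comp_continuousOn hg).congr fun x hx => ?_
  exact (hw x hx).hasFDerivAt.fderiv

/-- The potential is a multiple of `r^q - |x - c|^q`, with the factor fixed by matching gradients.
For `q` conjugate to `p` it solves the torsion equation. -/
lemma exists_torsion_ball {n : ℕ} (hn : 0 < n) {q : ℝ} (hq : 1 < q) (c : E) (r : ℝ) :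
    ∃ w : E → ℝ, (∀ x, ‖x - c‖ = r → w x = 0) ∧
      ∀ x, HasGradientAt w (pField q ((-(1 / n) : ℝ) • (x - c))) x := by
  set K : ℝ := (1 / n : ℝ) ^ (q - 1) / q
  have hn' : (0 : ℝ) < 1 / n := by positivity
  refine ⟨fun x => K * (r ^ q - ‖x - c‖ ^ q), fun x hx => by simp [hx], fun x => ?_⟩
  rw [hasGradientAt_iff_hasFDerivAt]
  have h1 : HasFDerivAt (fun y : E => ‖y - c‖ ^ q)
      ((q * ‖x - c‖ ^ (q - 2)) • innerSL ℝ (x - c)) x :=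
    (HasFDerivAt.comp (g := fun z : E => ‖z‖ ^ q) (f := fun y => y - c) x
      (hasFDerivAt_norm_rpow (x - c) hq)
      ((hasFDerivAt_id x).sub_const c)).congr_fderiv (by ext; simp)
  refine ((h1.const_sub (r ^ q)).const_mul K).congr_fderiv ?_
  ext z
  have hnorm : ‖(-(1 / n) : ℝ) • (x - c)‖ = (1 / n) * ‖x - c‖ := by
    rw [norm_smul, norm_neg, Real.norm_of_nonneg hn'.le]
  have h2 : (1 / n : ℝ) ^ (q - 1) = (1 / n : ℝ) ^ (q - 2) * (1 / n) :=
    (rpow_sub_two_mul_self hq hn'.le).symm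
  simp only [pField, hnorm, Real.mul_rpow hn'.le (norm_nonneg _), K, h2,
    InnerProductSpace.toDual_apply_apply, real_inner_smul_left, smul_apply, neg_apply,
    innerSL_apply_apply, smul_eq_mul]
  field_simp

/-- This derivative encodes `n α + s α' = -1`, the condition that `α(|x - c|) (x - c)` have
divergence `-1`. -/
lemma hasDerivAt_annulus_coeff {n : ℕ} (hn : 0 < n) (R : ℝ) {s : ℝ} (hs : 0 < s) :
    HasDerivAt (fun s : ℝ => (R ^ n * (s ^ n)⁻¹ - 1) / n) (-(R ^ n * (s ^ n)⁻¹) / s) s := by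
  have h1 := (((hasDerivAt_pow n s).inv (by positivity)).const_mul (R ^ n)).sub_const 1
  refine (h1.div_const (n : ℝ)).congr_deriv ?_
  obtain ⟨m, rfl⟩ := Nat.exists_eq_succ_of_ne_zero hn.ne'
  simp only [Nat.succ_eq_add_one, Nat.add_sub_cancel]
  field_simp
  ring

/-- The potential is the radial integral from `r` of `(α(s) s)^(q-1)`. Since `α ≥ 0` up to `R`, the
prescribed gradient points outward and `w` is nonnegative on the annulus. -/
lemma exists_torsion_annulus {n : ℕ} (hn : 0 < n) {q : ℝ} (hq : 1 < q) (c : E) {r R : ℝ}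
    (hr : 0 < r) :
    ∃ w : E → ℝ, (∀ x, ‖x - c‖ = r → w x = 0) ∧
      (∀ x, r ≤ ‖x - c‖ → ‖x - c‖ ≤ R → 0 ≤ w x) ∧
      ∀ x, x ≠ c → ‖x - c‖ ≤ R →
        HasGradientAt w (pField q (((R ^ n * (‖x - c‖ ^ n)⁻¹ - 1) / n) • (x - c))) x := by
  set α : ℝ → ℝ := fun s => (R ^ n * (s ^ n)⁻¹ - 1) / n
  set g : ℝ → ℝ := fun s => (α s * s) ^ (q - 1)
  have hαc : ContinuousOn α (Ioi 0) := fun s hs =>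
    (hasDerivAt_annulus_coeff hn R hs).continuousAt.continuousWithinAt
  have hgc : ContinuousOn g (Ioi 0) :=
    (Real.continuous_rpow_const (by linarith)).comp_continuousOn (hαc.mul continuousOn_id)
  have hα0 : ∀ s, 0 < s → s ≤ R → 0 ≤ α s := fun s hs hsR => by
    have h1 : s ^ n ≤ R ^ n := pow_le_pow_left₀ hs.le hsR n
    have h2 : 1 ≤ R ^ n * (s ^ n)⁻¹ := by
      rw [← div_eq_mul_inv, one_le_div (by positivity)]
      exact h1
    exact div_nonneg (by linarith) (Nat.cast_nonneg n)
  have hsub : ∀ s, 0 < s → uIcc r s ⊆ Ioi 0 := fun s hs t ht =>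
    lt_of_lt_of_le (lt_min hr hs) ht.1
  refine ⟨fun x => ∫ t in r..‖x - c‖, g t, fun x hx => by simp [hx], fun x h1 h2 => ?_,
    fun x hx hxR => ?_⟩
  · refine intervalIntegral.integral_nonneg h1 fun t ht => Real.rpow_nonneg ?_ _
    have ht0 : 0 < t := hr.trans_le ht.1
    exact mul_nonneg (hα0 t ht0 (ht.2.trans h2)) ht0.le
  · have hpos : 0 < ‖x - c‖ := norm_pos_iff.2 (sub_ne_zero.2 hx)
    have hd : HasDerivAt (fun s => ∫ t in r..s, g t) (g ‖x - c‖) ‖x - c‖ :=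
      intervalIntegral.integral_hasDerivAt_right
        ((hgc.mono (hsub _ hpos)).intervalIntegrable)
        (hgc.stronglyMeasurableAtFilter isOpen_Ioi _ hpos)
        (hgc.continuousAt (Ioi_mem_nhds hpos))
    convert hd.hasGradientAt_radial hx using 1
    have h0 := hα0 _ hpos hxR
    rw [pField, norm_smul, Real.norm_of_nonneg h0, smul_smul]
    congr 1
    rw [eq_div_iff hpos.ne', mul_assoc]
    exact rpow_sub_two_mul_self hq (by positivity)

variable [MeasurableSpace E] [BorelSpace E]

lemma integral_pField_of_radial {p : ℝ} (hp : 1 < p) {D : Set E} (hD : IsOpen D) {a : E → ℝ}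
    (ha : ContDiffOn ℝ 1 a D) {c : E}
    (hdiv : ∀ x ∈ D, Module.finrank ℝ E * a x + fderiv ℝ a x (x - c) = -1) {w : E → ℝ}
    (hw : ∀ x ∈ D, HasGradientAt w (pField (1 / (p - 1) + 1) (a x • (x - c))) x)
    {φ : E → ℝ} (hφ : ContDiff ℝ 1 φ) (hc : HasCompactSupport φ) (hsupp : tsupport φ ⊆ D) :
    ∫ x, ⟪pField p (∇ w x), ∇ φ x⟫ = ∫ x, φ x := by
  rw [← integral_inner_radial hD ha hdiv hφ hc hsupp]
  congr 1
  ext x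
  by_cases hx : x ∈ tsupport φ
  · rw [(hw x (hsupp hx)).gradient, pField_pField_conj hp]
  · rw [gradient_eq_zero_of_notMem_tsupport hx, inner_zero_right, inner_zero_right]

end Barriers

/-! ### Touching balls: shrinking, uniformity, existence -/

section TouchingBalls

variable {E : Type*} [NormedAddCommGroup E] [InnerProductSpace ℝ E]

/-- Move the centre towards the contact point. Downward closure of the radii serves both the
compactness argument and the passage to the optimal exterior radius. -/
lemma exists_touching_ball_of_le {S : Set E} {x : E} {r r' : ℝ} (hr' : 0 < r') (hle : r' ≤ r)
    (h : ∃ c, Metric.ball c r ⊆ S ∧ x ∈ Metric.sphere c r) :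
    ∃ c, Metric.ball c r' ⊆ S ∧ x ∈ Metric.sphere c r' := by
  obtain ⟨c, hc, hx⟩ := h
  have hr : 0 < r := hr'.trans_le hle
  have hxc : ‖c - x‖ = r := by rw [← dist_eq_norm, dist_comm]; exact hx
  refine ⟨x + (r' / r) • (c - x), (Metric.ball_subset_ball' ?_).trans hc, ?_⟩
  · have : x + (r' / r) • (c - x) - c = -((1 - r' / r) • (c - x)) := by
      rw [sub_smul, one_smul]
      abel
    have h1 : 0 ≤ 1 - r' / r := sub_nonneg.2 ((div_le_one hr).2 hle)
    rw [dist_eq_norm, this, norm_neg, norm_smul, Real.norm_of_nonneg h1, hxc]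
    field_simp
    linarith
  · rw [Metric.mem_sphere, dist_self_add_right, norm_smul, hxc,
      Real.norm_of_nonneg (by positivity)]
    field_simp

lemma exists_uniform_touching_radius {S K : Set E} (hK : IsCompact K)
    (h : ∀ x₀ ∈ K, ∃ r > 0, ∀ᶠ x in nhdsWithin x₀ K,
      ∃ c, Metric.ball c r ⊆ S ∧ x ∈ Metric.sphere c r) :
    ∃ r > 0, ∀ x ∈ K, ∃ c, Metric.ball c r ⊆ S ∧ x ∈ Metric.sphere c r := by
  refine hK.induction_on
    (p := fun T => ∃ r > 0, ∀ x ∈ T, ∃ c, Metric.ball c r ⊆ S ∧ x ∈ Metric.sphere c r)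
    ⟨1, one_pos, by simp⟩ ?_ ?_ ?_
  · rintro s t hst ⟨r, hr, ht⟩
    exact ⟨r, hr, fun x hx => ht x (hst hx)⟩
  · rintro s t ⟨r₁, h₁, hs⟩ ⟨r₂, h₂, ht⟩
    refine ⟨min r₁ r₂, lt_min h₁ h₂, fun x hx => ?_⟩
    rcases hx with hx | hx
    · exact exists_touching_ball_of_le (lt_min h₁ h₂) (min_le_left _ _) (hs x hx)
    · exact exists_touching_ball_of_le (lt_min h₁ h₂) (min_le_right _ _) (ht x hx)
  · intro x hx
    obtain ⟨r, hr, hev⟩ := h x hx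
    exact ⟨_, hev, r, hr, fun y hy => hy⟩

variable [CompleteSpace E]

/-- Near a regular point of a `C²` function `φ`, the points of `{φ = 0}` are touched from inside
`{φ < 0}` by balls of a fixed radius. -/
lemma exists_touching_ball_sublevel {U : Set E} (hU : IsOpen U) {φ : E → ℝ}
    (hφ : ContDiffOn ℝ 2 φ U) {x₀ : E} (hx₀ : x₀ ∈ U) (hgrad : ∇ φ x₀ ≠ 0) :
    ∃ r > 0, ∀ᶠ x in nhds x₀, φ x = 0 →
      ∃ c, Metric.ball c r ⊆ {y ∈ U | φ y < 0} ∧ x ∈ Metric.sphere c r := by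
  have hφ' : ContDiffAt ℝ 1 (fderiv ℝ φ) x₀ :=
    (hφ.contDiffAt (hU.mem_nhds hx₀)).fderiv_right (by norm_num)
  obtain ⟨L, t, ht, hL⟩ := hφ'.exists_lipschitzOnWith
  set m := ‖∇ φ x₀‖ / 2
  have hm : 0 < m := by
    have := norm_pos_iff.2 hgrad
    positivity
  have hgc : ContinuousAt (fun x => ‖∇ φ x‖) x₀ :=
    ((InnerProductSpace.toDual ℝ E).symm.continuous.continuousAt.comp hφ'.continuousAt).norm
  have hev : ∀ᶠ x in nhds x₀, m < ‖∇ φ x‖ := by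
    refine hgc.eventually (lt_mem_nhds ?_)
    simp only [m] at hm ⊢
    linarith
  obtain ⟨ε, hε, hball⟩ := Metric.mem_nhds_iff.1
    (Filter.inter_mem (Filter.inter_mem (hU.mem_nhds hx₀) ht) hev)
  -- The first bound keeps the touching ball inside the `ε`-ball around `x₀`; the second lets the
  -- linear term of the Taylor expansion beat the quadratic error.
  set r := min (ε / 4) (m / (2 * (L + 1)))
  have hL0 : (0 : ℝ) ≤ L := L.2
  have hr : 0 < r := by positivity
  refine ⟨r, hr, ?_⟩
  filter_upwards [Metric.ball_mem_nhds x₀ (half_pos hε)] with x hx hx0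
  have hxε : x ∈ Metric.ball x₀ ε := Metric.ball_subset_ball (by linarith) hx
  have hgx : m < ‖∇ φ x‖ := (hball hxε).2
  have hgx0 : 0 < ‖∇ φ x‖ := hm.trans hgx
  set ν : E := ‖∇ φ x‖⁻¹ • ∇ φ x
  have hν : ‖ν‖ = 1 := by
    simp only [ν, norm_smul, norm_inv, norm_norm]
    field_simp
  have hνφ : ∇ φ x = ‖∇ φ x‖ • ν := by
    simp only [ν, smul_smul]
    rw [mul_inv_cancel₀ hgx0.ne', one_smul]
  refine ⟨x - r • ν, fun y hy => ?_, ?_⟩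
  swap
  · rw [Metric.mem_sphere, dist_eq_norm, sub_sub_cancel, norm_smul, hν, Real.norm_of_nonneg hr.le,
      mul_one]
  have hy' : ‖(y - x) + r • ν‖ < r := by
    rw [Metric.mem_ball, dist_eq_norm] at hy
    rwa [show (y - x) + r • ν = y - (x - r • ν) by abel]
  have hyx : ‖y - x‖ < ε / 2 := by
    have h1 : ‖y - x‖ ≤ ‖(y - x) + r • ν‖ + ‖r • ν‖ := by
      simpa using norm_sub_le ((y - x) + r • ν) (r • ν)
    rw [norm_smul, hν, Real.norm_of_nonneg hr.le, mul_one] at h1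
    have : r ≤ ε / 4 := min_le_left _ _
    linarith
  have hyε : y ∈ Metric.ball x₀ ε := by
    rw [Metric.mem_ball] at hx ⊢
    rw [← dist_eq_norm] at hyx
    linarith [dist_triangle y x x₀]
  -- Membership in the ball, expanded: `|y - x|²` is less than `-2r ⟪y - x, ν⟫`. With `2r(L + 1) ≤ m
  -- < ‖∇ φ x‖`, Taylor's bound then gives `φ y < -|y - x|² ≤ 0`.
  have hsq : ‖y - x‖ ^ 2 + 2 * r * ⟪y - x, ν⟫ < 0 := by
    have h1 : ‖(y - x) + r • ν‖ ^ 2 < r ^ 2 := pow_lt_pow_left₀ hy' (norm_nonneg _) two_ne_zero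
    rw [norm_add_sq_real, real_inner_smul_right, norm_smul, hν, Real.norm_of_nonneg hr.le] at h1
    linarith
  refine ⟨(hball hyε).1.1, ?_⟩
  have htaylor : ‖φ y - φ x - fderiv ℝ φ x (y - x)‖ ≤ (L * ‖y - x‖) * ‖y - x‖ := by
    refine Convex.norm_image_sub_le_of_norm_fderiv_le' (𝕜 := ℝ)
      (s := Metric.ball x₀ ε ∩ Metric.closedBall x ‖y - x‖) ?_ ?_
      ((convex_ball _ _).inter (convex_closedBall _ _)) ⟨hxε, by simp⟩
      ⟨hyε, by simp [dist_eq_norm]⟩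
    · intro z hz
      exact (hφ.contDiffAt (hU.mem_nhds (hball hz.1).1.1)).differentiableAt two_ne_zero
    · intro z hz
      have h1 := hL.dist_le_mul z (hball hz.1).1.2 x (hball hxε).1.2
      rw [dist_eq_norm, dist_eq_norm] at h1
      have h2 : ‖z - x‖ ≤ ‖y - x‖ := by simpa [dist_eq_norm] using hz.2
      exact h1.trans (mul_le_mul_of_nonneg_left h2 hL0)
  have hlin : fderiv ℝ φ x (y - x) = ‖∇ φ x‖ * ⟪y - x, ν⟫ := by
    rw [← inner_gradient_left (𝕜 := ℝ), hνφ, real_inner_smul_left, real_inner_comm, norm_smul, hν]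
    simp
  rw [hx0, hlin, Real.norm_eq_abs, abs_le] at htaylor
  have hrm : r * (2 * (L + 1)) ≤ m := by
    rw [← le_div_iff₀ (by positivity)]
    exact min_le_right _ _
  have hin : ⟪y - x, ν⟫ < 0 := by nlinarith [sq_nonneg ‖y - x‖]
  have h5 : ‖∇ φ x‖ * ⟪y - x, ν⟫ ≤ r * (2 * (L + 1)) * ⟪y - x, ν⟫ :=
    mul_le_mul_of_nonpos_right (hrm.trans hgx.le) hin.le
  have h6 : (L + 1) * (‖y - x‖ ^ 2 + 2 * r * ⟪y - x, ν⟫) < 0 :=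
    mul_neg_of_pos_of_neg (by positivity) hsq
  nlinarith [sq_nonneg ‖y - x‖, htaylor.2]

end TouchingBalls

/-! ### Touching radii of a bounded `C²` domain -/

section C2Domain

variable {N : ℕ} {Ω : Set (EuclideanSpace ℝ (Fin N))}

lemma IsBoundedC2Domain.isCompact_frontier (hΩ : IsBoundedC2Domain Ω) :
    IsCompact (frontier Ω) :=
  Metric.isCompact_of_isClosed_isBounded isClosed_frontier
    (hΩ.isBounded.closure.subset frontier_subset_closure)

lemma IsBoundedC2Domain.frontier_nonempty (hN : 0 < N) (hΩ : IsBoundedC2Domain Ω) :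
    (frontier Ω).Nonempty := by
  have : Nonempty (Fin N) := ⟨⟨0, hN⟩⟩
  rw [nonempty_iff_ne_empty]
  intro h
  rcases isClopen_iff.1 (isClopen_iff_frontier_eq_empty.2 h) with h1 | h1
  · exact hΩ.isConnected.nonempty.ne_empty h1
  · exact NormedSpace.unbounded_univ ℝ (EuclideanSpace ℝ (Fin N)) (h1 ▸ hΩ.isBounded)

lemma IsBoundedC2Domain.notMem_closure {U : Set (EuclideanSpace ℝ (Fin N))}
    {φ : EuclideanSpace ℝ (Fin N) → ℝ} (hU : IsOpen U) (hφ : ContinuousOn φ U)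
    (h : Ω ∩ U = {x ∈ U | φ x < 0}) {x : EuclideanSpace ℝ (Fin N)} (hx : x ∈ U)
    (hpos : 0 < φ x) : x ∉ closure Ω := by
  intro hcl
  have hev := (hφ.continuousAt (hU.mem_nhds hx)).eventually (lt_mem_nhds hpos)
  obtain ⟨y, ⟨hy1, hyU⟩, hyΩ⟩ := mem_closure_iff_nhds.1 hcl _
    (Filter.inter_mem hev (hU.mem_nhds hx))
  have h2 : y ∈ {x ∈ U | φ x < 0} := h ▸ ⟨hyΩ, hyU⟩
  exact lt_asymm h2.2 hy1

lemma IsBoundedC2Domain.eq_zero_of_mem_frontier {U : Set (EuclideanSpace ℝ (Fin N))}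
    {φ : EuclideanSpace ℝ (Fin N) → ℝ} (hΩ : IsOpen Ω) (hU : IsOpen U) (hφ : ContinuousOn φ U)
    (h : Ω ∩ U = {x ∈ U | φ x < 0}) {x : EuclideanSpace ℝ (Fin N)} (hx : x ∈ U)
    (hxf : x ∈ frontier Ω) : φ x = 0 := by
  rw [hΩ.frontier_eq] at hxf
  rcases lt_trichotomy (φ x) 0 with h1 | h1 | h1
  · have : x ∈ Ω ∩ U := h ▸ ⟨hx, h1⟩
    exact absurd this.1 hxf.2
  · exact h1
  · exact absurd hxf.1 (notMem_closure hU hφ h hx h1)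

lemma IsBoundedC2Domain.nonempty_interiorTouchingRadii (hΩ : IsBoundedC2Domain Ω) :
    (interiorTouchingRadii Ω).Nonempty := by
  obtain ⟨r, hr, h⟩ := exists_uniform_touching_radius (S := Ω) hΩ.isCompact_frontier (by
    intro x₀ hx₀
    obtain ⟨U, φ, hU, hxU, hφ, hg, heq⟩ := hΩ.regular_boundary x₀ hx₀
    obtain ⟨r, hr, hev⟩ := exists_touching_ball_sublevel hU hφ hxU hg
    refine ⟨r, hr, ?_⟩
    filter_upwards [nhdsWithin_le_nhds hev, nhdsWithin_le_nhds (hU.mem_nhds hxU),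
      self_mem_nhdsWithin] with x h1 h2 h3
    obtain ⟨c, hc, hxc⟩ := h1 (eq_zero_of_mem_frontier hΩ.isOpen hU hφ.continuousOn heq h2 h3)
    exact ⟨c, fun y hy => (heq.symm.subset (hc hy)).1, hxc⟩)
  exact ⟨r, hr, h⟩

lemma IsBoundedC2Domain.nonempty_exteriorTouchingRadii (hΩ : IsBoundedC2Domain Ω) :
    (exteriorTouchingRadii Ω).Nonempty := by
  obtain ⟨r, hr, h⟩ := exists_uniform_touching_radius (S := (closure Ω)ᶜ)
    hΩ.isCompact_frontier (by
    intro x₀ hx₀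
    obtain ⟨U, φ, hU, hxU, hφ, hg, heq⟩ := hΩ.regular_boundary x₀ hx₀
    -- Applied to `-φ`, the same lemma gives balls in `{φ > 0}`, which misses the closure of `Ω`.
    obtain ⟨r, hr, hev⟩ := exists_touching_ball_sublevel hU hφ.neg hxU (by
      rw [gradient, show fderiv ℝ (fun x => -φ x) x₀ = -fderiv ℝ φ x₀ from fderiv_fun_neg,
        map_neg]
      exact neg_ne_zero.2 hg)
    refine ⟨r, hr, ?_⟩
    filter_upwards [nhdsWithin_le_nhds hev, nhdsWithin_le_nhds (hU.mem_nhds hxU),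
      self_mem_nhdsWithin] with x h1 h2 h3
    obtain ⟨c, hc, hxc⟩ := h1 (by
      rw [eq_zero_of_mem_frontier hΩ.isOpen hU hφ.continuousOn heq h2 h3, neg_zero])
    exact ⟨c, fun y hy => notMem_closure hU hφ.continuousOn heq (hc hy).1
      (neg_neg_iff_pos.1 (hc hy).2), hxc⟩)
  exact ⟨r, hr, h⟩

lemma IsBoundedC2Domain.bddAbove_interiorTouchingRadii (hN : 0 < N) (hΩ : IsBoundedC2Domain Ω) :
    BddAbove (interiorTouchingRadii Ω) := by
  obtain ⟨x₀, hx₀⟩ := hΩ.frontier_nonempty hN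
  refine ⟨Metric.diam (closure Ω), fun r hr => ?_⟩
  obtain ⟨c, hc, hx⟩ := hr.2 x₀ hx₀
  rw [← Metric.mem_sphere.1 hx]
  exact Metric.dist_le_diam_of_mem hΩ.isBounded.closure (frontier_subset_closure hx₀)
    (subset_closure (hc (Metric.mem_ball_self hr.1)))

end C2Domain

/-! ### One-sided derivatives at the boundary -/

section BoundaryGradient

open Filter Topology

lemma HasDerivWithinAt.le_of_eventually_le {f g : ℝ → ℝ} {f' g' a : ℝ}
    (hf : HasDerivWithinAt f f' (Ici a) a) (hg : HasDerivWithinAt g g' (Ici a) a)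
    (ha : f a = g a) (hle : ∀ᶠ t in 𝓝[>] a, f t ≤ g t) : f' ≤ g' := by
  rw [hasDerivWithinAt_iff_tendsto_slope, Ici_sdiff_left] at hf hg
  refine le_of_tendsto_of_tendsto hf hg ?_
  filter_upwards [hle, self_mem_nhdsWithin] with t ht hta
  have : 0 < t - a := sub_pos.2 hta
  rw [slope_def_field, slope_def_field, ha]
  gcongr

lemma eventually_add_smul_mem_ball {E : Type*} [NormedAddCommGroup E] [InnerProductSpace ℝ E]
    {c x e : E} {r : ℝ} (hx : x ∈ Metric.sphere c r) (he : 0 < ⟪e, c - x⟫) :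
    ∀ᶠ t : ℝ in 𝓝[>] 0, x + t • e ∈ Metric.ball c r := by
  have h1 : ∀ᶠ t : ℝ in 𝓝[>] 0, t * ‖e‖ ^ 2 < 2 * ⟪e, c - x⟫ := by
    refine nhdsWithin_le_nhds (ContinuousAt.eventually_lt (by fun_prop) (by fun_prop) ?_)
    rw [zero_mul]
    positivity
  filter_upwards [h1, self_mem_nhdsWithin] with t ht ht0
  have ht0' : (0 : ℝ) < t := ht0
  have hr : ‖x - c‖ = r := by rw [← dist_eq_norm]; exact hx
  have hr0 : 0 ≤ r := hr ▸ norm_nonneg _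
  rw [Metric.mem_ball, dist_eq_norm, show x + t • e - c = (x - c) + t • e by abel]
  refine lt_of_pow_lt_pow_left₀ 2 hr0 ?_
  have h2 : ⟪x - c, e⟫ = -⟪e, c - x⟫ := by
    rw [real_inner_comm, ← inner_neg_right, neg_sub]
  rw [norm_add_sq_real, hr, real_inner_smul_right, h2, norm_smul, Real.norm_of_nonneg ht0'.le]
  nlinarith

/-- A vector with nonnegative products against an open half-space of directions, bounded there
by `B` times the length of the direction, has length at most `B`. -/
lemma norm_le_of_inner_bounds_halfspace {E : Type*} [NormedAddCommGroup E]
    [InnerProductSpace ℝ E] {G ν : E} {B : ℝ} (hν : ν ≠ 0)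
    (hB : 0 ≤ B) (h0 : ∀ e, 0 < ⟪e, ν⟫ → 0 ≤ ⟪G, e⟫)
    (h1 : ∀ e, 0 < ⟪e, ν⟫ → ⟪G, e⟫ ≤ B * ‖e‖) : ‖G‖ ≤ B := by
  have hν2 : 0 < ⟪ν, ν⟫ := real_inner_self_pos.2 hν
  rcases lt_or_ge 0 ⟪G, ν⟫ with h | h
  · have h2 := h1 G h
    rw [real_inner_self_eq_norm_sq] at h2
    rcases (norm_nonneg G).eq_or_lt with h3 | h3
    · rwa [← h3]
    · nlinarith
  · have h3 : ⟪G, ν⟫ = 0 := le_antisymm h (h0 ν hν2)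
    -- Otherwise `G ⊥ ν`, so `ν - G` is admissible, and nonnegativity reads `-|G|² ≥ 0`.
    have h4 := h0 (ν - G) (by rw [inner_sub_left, h3, sub_zero]; exact hν2)
    rw [inner_sub_right, h3, real_inner_self_eq_norm_sq, zero_sub] at h4
    have : ‖G‖ = 0 := pow_eq_zero_iff two_ne_zero |>.1 (le_antisymm (by linarith) (by positivity))
    rwa [this]

lemma HasGradientAt.hasDerivWithinAt_ray {E : Type*} [NormedAddCommGroup E]
    [InnerProductSpace ℝ E] [CompleteSpace E] {w : E → ℝ} {g x e : E} (h : HasGradientAt w g x)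
    (s : Set ℝ) : HasDerivWithinAt (fun t : ℝ => w (x + t • e)) ⟪g, e⟫ s 0 := by
  have h1 : HasDerivAt (fun t : ℝ => x + t • e) e 0 := by
    simpa using ((hasDerivAt_id (0 : ℝ)).smul_const e).const_add x
  have h2 : HasFDerivAt w (InnerProductSpace.toDual ℝ E g) (x + (0 : ℝ) • e) := by
    rw [zero_smul, add_zero]
    exact h
  exact (h2.comp_hasDerivAt (0 : ℝ) h1).hasDerivWithinAt

variable {N : ℕ} {Ω : Set (EuclideanSpace ℝ (Fin N))} {u : EuclideanSpace ℝ (Fin N) → ℝ}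

lemma IsC1UpToBoundary.tendsto_gradient (hu : IsC1UpToBoundary Ω u)
    {x₀ : EuclideanSpace ℝ (Fin N)} (hx₀ : x₀ ∈ closure Ω) :
    Tendsto (∇ u) (𝓝[Ω] x₀) (𝓝 (closureGradient Ω u x₀)) := by
  obtain ⟨G, hG, hGu⟩ := hu.exists_extension
  refine tendsto_extendFrom ⟨G x₀, ?_⟩
  exact (((hG x₀ hx₀).mono subset_closure).tendsto).congr' (by
    filter_upwards [self_mem_nhdsWithin] with x hx using hGu x hx)

/-- A function continuous at the endpoint whose derivative has a limit there is one-sidedly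
differentiable with that limit as derivative. -/
lemma IsC1UpToBoundary.hasDerivWithinAt_ray (hΩ : IsOpen Ω) (hu : IsC1UpToBoundary Ω u)
    {x₀ e : EuclideanSpace ℝ (Fin N)} (hx₀ : x₀ ∈ closure Ω)
    (he : ∀ᶠ t : ℝ in 𝓝[>] 0, x₀ + t • e ∈ Ω) :
    HasDerivWithinAt (fun t : ℝ => u (x₀ + t • e)) ⟪closureGradient Ω u x₀, e⟫ (Ici 0) 0 := by
  have hline : ∀ t : ℝ, HasDerivAt (fun t : ℝ => x₀ + t • e) e t := fun t => by
    simpa using ((hasDerivAt_id t).smul_const e).const_add x₀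
  have hder : ∀ t : ℝ, x₀ + t • e ∈ Ω →
      HasDerivAt (fun t : ℝ => u (x₀ + t • e)) ⟪∇ u (x₀ + t • e), e⟫ t := fun t ht => by
    have h1 := ((hu.contDiffOn.contDiffAt (hΩ.mem_nhds ht)).differentiableAt
      one_ne_zero).hasFDerivAt
    rw [inner_gradient_left]
    exact h1.comp_hasDerivAt t (hline t)
  have hcont : Continuous fun t : ℝ => x₀ + t • e := by fun_prop
  refine hasDerivWithinAt_Ici_of_tendsto_deriv (s := {t : ℝ | x₀ + t • e ∈ Ω})
    (fun t ht => (hder t ht).differentiableAt.differentiableWithinAt) ?_ he ?_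
  · have h1 : ContinuousWithinAt u (closure Ω) (x₀ + (0 : ℝ) • e) := by
      rw [zero_smul, add_zero]
      exact hu.continuousOn x₀ hx₀
    exact ContinuousWithinAt.comp (f := fun t : ℝ => x₀ + t • e) h1 hcont.continuousWithinAt
      fun t ht => subset_closure ht
  · have h1 : Tendsto (fun t : ℝ => x₀ + t • e) (𝓝[>] 0) (𝓝[Ω] x₀) := by
      refine tendsto_nhdsWithin_iff.2 ⟨?_, he⟩
      have := (hcont.tendsto 0).mono_left (nhdsWithin_le_nhds (s := Ioi 0))
      simpa using this
    have h2 := ((hu.tendsto_gradient hx₀).comp h1).inner (𝕜 := ℝ)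
      (tendsto_const_nhds (x := e))
    refine h2.congr' ?_
    filter_upwards [he] with t ht using (hder t ht).deriv.symm

end BoundaryGradient

/-! ### Gradient bounds and passage to the optimal radii -/

section Torsion

open Filter Topology

variable {N : ℕ} {p : ℝ} {Ω : Set (EuclideanSpace ℝ (Fin N))}
  {u : EuclideanSpace ℝ (Fin N) → ℝ}

lemma SolvesPTorsion.integral_eq (hp : 1 < p) (hΩ : IsOpen Ω) (hu : IsC1UpToBoundary Ω u)
    (hsol : SolvesPTorsion p Ω u) {φ : EuclideanSpace ℝ (Fin N) → ℝ} (hφ : ContDiff ℝ 1 φ)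
    (hc : HasCompactSupport φ) (hsupp : tsupport φ ⊆ Ω) :
    ∫ x, ⟪pField p (∇ u x), ∇ φ x⟫ = ∫ x, φ x := by
  refine weak_eq_of_contDiff_one hΩ ((continuous_pField hp).comp_continuousOn
    (hu.contDiffOn.continuousOn_gradient hΩ)) (fun ψ hψ hψc hψs => ?_) hφ hc hsupp
  have h := hsol.weak_eq ψ hψ hψc hψs
  rw [setIntegral_eq_integral_of_forall_compl_eq_zero,
    setIntegral_eq_integral_of_forall_compl_eq_zero] at h
  · exact h
  · exact fun x hx => image_eq_zero_of_notMem_tsupport fun h => hx (hψs h)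
  · intro x hx
    rw [gradient_eq_zero_of_notMem_tsupport fun h => hx (hψs h), inner_zero_right]

lemma SolvesPTorsion.nonneg (hN : 0 < N) (hp : 1 < p) (hΩ : IsBoundedC2Domain Ω)
    (hu : IsC1UpToBoundary Ω u) (hsol : SolvesPTorsion p Ω u) : ∀ x ∈ closure Ω, 0 ≤ u x := by
  have : Nonempty (Fin N) := ⟨⟨0, hN⟩⟩
  refine pLaplace_comparison hp hΩ.isOpen hΩ.isBounded contDiffOn_const hu.contDiffOn
    continuousOn_const hu.continuousOn (fun x hx => (hsol.boundary_eq x hx).ge)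
    fun φ hφ hc hs hpos => ?_
  rw [hsol.integral_eq hp hΩ.isOpen hu hφ hc hs]
  simp only [gradient_fun_const, pField, smul_zero, inner_zero_left, integral_zero]
  exact integral_nonneg hpos

lemma SolvesPTorsion.lower_bound (hN : 0 < N) (hp : 1 < p) (hΩ : IsBoundedC2Domain Ω)
    (hu : IsC1UpToBoundary Ω u) (hsol : SolvesPTorsion p Ω u) {x₀ : EuclideanSpace ℝ (Fin N)}
    (hx₀ : x₀ ∈ frontier Ω) {r : ℝ} (hr : r ∈ interiorTouchingRadii Ω) :
    (r / N) ^ (1 / (p - 1)) ≤ ‖closureGradient Ω u x₀‖ := by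
  have : Nonempty (Fin N) := ⟨⟨0, hN⟩⟩
  have hp' : 0 < p - 1 := by linarith
  set q : ℝ := 1 / (p - 1) + 1 with hqdef
  have hq : 1 < q := by
    have : 0 < 1 / (p - 1) := by positivity
    linarith
  have hN' : (0 : ℝ) < N := by exact_mod_cast hN
  have hr0 := hr.1
  obtain ⟨c, hc, hxc⟩ := hr.2 x₀ hx₀
  have hxr : ‖x₀ - c‖ = r := by rw [← dist_eq_norm]; exact hxc
  obtain ⟨w, hw0, hwg⟩ := exists_torsion_ball hN hq c r
  have hwC : ContDiffOn ℝ 1 w (Metric.ball c r) :=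
    contDiffOn_of_hasGradientAt Metric.isOpen_ball
      (((continuous_pField hq).comp (by fun_prop)).continuousOn) fun x _ => hwg x
  have hle : ∀ x ∈ closure (Metric.ball c r), w x ≤ u x := by
    refine pLaplace_comparison hp Metric.isOpen_ball Metric.isBounded_ball hwC
      (hu.contDiffOn.mono hc) (fun x _ => (hwg x).continuousAt.continuousWithinAt)
      (hu.continuousOn.mono (closure_mono hc)) (fun x hx => ?_) fun φ hφ hφc hs _ => le_of_eq ?_
    · rw [frontier_ball c hr0.ne', mem_sphere_iff_norm] at hx
      rw [hw0 x hx]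
      refine hsol.nonneg hN hp hΩ hu x (closure_mono hc ?_)
      rw [closure_ball c hr0.ne', mem_closedBall_iff_norm, hx]
    · rw [hsol.integral_eq hp hΩ.isOpen hu hφ hφc (hs.trans hc)]
      refine integral_pField_of_radial hp Metric.isOpen_ball (a := fun _ => -(1 / N : ℝ))
        contDiffOn_const (fun x _ => ?_) (fun x _ => hwg x) hφ hφc hs
      rw [fderiv_fun_const, finrank_euclideanSpace_fin]
      simp
      field_simp
  have hdir : 0 < ⟪c - x₀, c - x₀⟫ :=
    real_inner_self_pos.2 (norm_pos_iff.1 (by rw [norm_sub_rev, hxr]; exact hr0))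
  have hball := eventually_add_smul_mem_ball hxc hdir
  have hd1 := hu.hasDerivWithinAt_ray hΩ.isOpen (frontier_subset_closure hx₀)
    (hball.mono fun t ht => hc ht)
  have hd2 := (hwg x₀).hasDerivWithinAt_ray (e := c - x₀) (Ici 0)
  have hcmp := hd2.le_of_eventually_le hd1
    (by simp only [zero_smul, add_zero]; rw [hw0 x₀ hxr, hsol.boundary_eq x₀ hx₀])
    (hball.mono fun t ht => hle _ (subset_closure ht))
  have h1 : ⟪closureGradient Ω u x₀, c - x₀⟫ ≤ ‖closureGradient Ω u x₀‖ * r := by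
    refine (real_inner_le_norm _ _).trans_eq ?_
    rw [norm_sub_rev, hxr]
  have hnv : ‖(-(1 / N : ℝ)) • (x₀ - c)‖ = r / N := by
    rw [norm_smul, norm_neg, Real.norm_of_nonneg (by positivity), hxr]
    ring
  have h2 : ⟪pField q ((-(1 / N : ℝ)) • (x₀ - c)), c - x₀⟫ = (r / N) ^ (1 / (p - 1)) * r := by
    have e1 : ⟪x₀ - c, c - x₀⟫ = -r ^ 2 := by
      rw [← neg_sub x₀ c, inner_neg_right, real_inner_self_eq_norm_sq, hxr]
    rw [show (1 / (p - 1)) = q - 1 by rw [hqdef]; ring, pField, hnv, real_inner_smul_left,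
      real_inner_smul_left, e1, ← rpow_sub_two_mul_self hq (by positivity)]
    ring
  rw [h2] at hcmp
  exact le_of_mul_le_mul_right (hcmp.trans h1) hr0

lemma SolvesPTorsion.upper_bound (hN : 0 < N) (hp : 1 < p) (hΩ : IsBoundedC2Domain Ω)
    (hu : IsC1UpToBoundary Ω u) (hsol : SolvesPTorsion p Ω u) {x₀ : EuclideanSpace ℝ (Fin N)}
    (hx₀ : x₀ ∈ frontier Ω) {r : ℝ} (hr : r ∈ exteriorTouchingRadii Ω) :
    ‖closureGradient Ω u x₀‖ ≤
      ((Metric.diam Ω + r) ^ N / (N * r ^ (N - 1)) - r / N) ^ (1 / (p - 1)) := by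
  have : Nonempty (Fin N) := ⟨⟨0, hN⟩⟩
  have hp' : 0 < p - 1 := by linarith
  set q : ℝ := 1 / (p - 1) + 1 with hqdef
  have hq : 1 < q := by
    have : 0 < 1 / (p - 1) := by positivity
    linarith
  have hN' : (0 : ℝ) < N := by exact_mod_cast hN
  have hr0 := hr.1
  obtain ⟨c, hc, hxc⟩ := hr.2 x₀ hx₀
  have hxr : ‖x₀ - c‖ = r := by rw [← dist_eq_norm]; exact hxc
  set d := Metric.diam Ω
  have hd : 0 ≤ d := Metric.diam_nonneg
  -- Every point of the closure is within `d` of `x₀`, which is at distance `r` from `c`.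
  set R := d + r
  have hcl1 : ∀ x ∈ closure Ω, r ≤ ‖x - c‖ := fun x hx => by
    by_contra! h
    exact hc (mem_ball_iff_norm.2 h) hx
  have hcl2 : ∀ x ∈ closure Ω, ‖x - c‖ ≤ R := fun x hx => by
    have h1 : dist x x₀ ≤ d := by
      rw [show d = Metric.diam Ω from rfl, ← Metric.diam_closure]
      exact Metric.dist_le_diam_of_mem hΩ.isBounded.closure hx (frontier_subset_closure hx₀)
    rw [← dist_eq_norm]
    have h2 := dist_triangle x x₀ c
    rw [Metric.mem_sphere.1 hxc] at h2
    linarith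
  have hne : ∀ x ∈ closure Ω, x ≠ c := fun x hx h => by
    have := hcl1 x hx
    rw [h, sub_self, norm_zero] at this
    linarith
  obtain ⟨w, hw0, hwpos, hwg⟩ := exists_torsion_annulus hN hq c (R := R) hr0
  have hwg' : ∀ x ∈ closure Ω, HasGradientAt w _ x := fun x hx => hwg x (hne x hx) (hcl2 x hx)
  set a : EuclideanSpace ℝ (Fin N) → ℝ := fun x => (R ^ N * (‖x - c‖ ^ N)⁻¹ - 1) / N
  have haC : ContDiffOn ℝ 1 a Ω := by
    have h1 : ContDiffOn ℝ 1 (fun x : EuclideanSpace ℝ (Fin N) => ‖x - c‖) Ω :=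
      (contDiffOn_id.sub contDiffOn_const).norm ℝ
        fun x hx => sub_ne_zero.2 (hne x (subset_closure hx))
    refine ContDiffOn.div_const (ContDiffOn.sub (contDiffOn_const.mul
      ((h1.pow N).inv fun x hx => ?_)) contDiffOn_const) _
    have := norm_pos_iff.2 (sub_ne_zero.2 (hne x (subset_closure hx)))
    positivity
  have hwC : ContDiffOn ℝ 1 w Ω :=
    contDiffOn_of_hasGradientAt hΩ.isOpen
      ((continuous_pField hq).comp_continuousOn
        (haC.continuousOn.smul (continuousOn_id.sub continuousOn_const)))
      fun x hx => hwg' x (subset_closure hx)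
  have hle : ∀ x ∈ closure Ω, u x ≤ w x := by
    refine pLaplace_comparison hp hΩ.isOpen hΩ.isBounded hu.contDiffOn hwC hu.continuousOn
      (fun x hx => (hwg' x hx).continuousAt.continuousWithinAt) (fun x hx => ?_)
      fun φ hφ hφc hs _ => le_of_eq ?_
    · rw [hsol.boundary_eq x hx]
      have hx' := frontier_subset_closure hx
      exact hwpos x (hcl1 x hx') (hcl2 x hx')
    · rw [hsol.integral_eq hp hΩ.isOpen hu hφ hφc hs]
      refine (integral_pField_of_radial hp hΩ.isOpen haC (c := c) (fun x hx => ?_)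
        (fun x hx => hwg' x (subset_closure hx)) hφ hφc hs).symm
      have hxc' := hne x (subset_closure hx)
      have hpos := norm_pos_iff.2 (sub_ne_zero.2 hxc')
      have hg := (hasDerivAt_annulus_coeff hN R hpos).hasGradientAt_radial hxc'
      rw [finrank_euclideanSpace_fin, hg.fderiv_apply, real_inner_smul_left,
        real_inner_self_eq_norm_sq]
      simp only [a]
      field_simp
      ring
  -- Any interior touching ball will do: it only provides an open half-space of directions entering
  -- `Ω`, where `0 ≤ u ≤ w` can be differentiated at `x₀`.
  obtain ⟨ρ, hρ⟩ := hΩ.nonempty_interiorTouchingRadii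
  obtain ⟨c', hc', hxc2⟩ := hρ.2 x₀ hx₀
  have hx₀' := frontier_subset_closure hx₀
  have hν : c' - x₀ ≠ 0 := by
    rw [← norm_pos_iff, norm_sub_rev, ← dist_eq_norm, Metric.mem_sphere.1 hxc2]
    exact hρ.1
  have ha0 : 0 ≤ a x₀ := by
    have h1 : r ^ N ≤ R ^ N := pow_le_pow_left₀ hr0.le (by simp only [R]; linarith) N
    have h2 : 1 ≤ R ^ N * (r ^ N)⁻¹ := by
      rw [← div_eq_mul_inv, one_le_div (by positivity)]
      exact h1
    simp only [a, hxr]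
    exact div_nonneg (by linarith) hN'.le
  have hB : ‖pField q (a x₀ • (x₀ - c))‖ =
      (R ^ N / (N * r ^ (N - 1)) - r / N) ^ (1 / (p - 1)) := by
    rw [norm_pField hq, norm_smul, Real.norm_of_nonneg ha0, hxr, hqdef, add_sub_cancel_right]
    congr 1
    simp only [a, hxr]
    obtain ⟨m, rfl⟩ := Nat.exists_eq_succ_of_ne_zero hN.ne'
    simp only [Nat.succ_eq_add_one, Nat.add_sub_cancel]
    field_simp
    ring
  rw [← hB]
  refine norm_le_of_inner_bounds_halfspace hν (norm_nonneg _) (fun e he => ?_) fun e he => ?_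
  · have hball := (eventually_add_smul_mem_ball hxc2 he).mono fun t ht => hc' ht
    have hd1 := hu.hasDerivWithinAt_ray hΩ.isOpen hx₀' hball
    refine (hasDerivWithinAt_const (0 : ℝ) (Ici 0) (0 : ℝ)).le_of_eventually_le hd1 ?_ ?_
    · simp only [zero_smul, add_zero]
      rw [hsol.boundary_eq x₀ hx₀]
    · exact hball.mono fun t ht => hsol.nonneg hN hp hΩ hu _ (subset_closure ht)
  · have hball := (eventually_add_smul_mem_ball hxc2 he).mono fun t ht => hc' ht
    have hd1 := hu.hasDerivWithinAt_ray hΩ.isOpen hx₀' hball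
    refine (hd1.le_of_eventually_le ((hwg' x₀ hx₀').hasDerivWithinAt_ray (Ici 0)) ?_ ?_).trans
      (real_inner_le_norm _ _)
    · simp only [zero_smul, add_zero]
      rw [hsol.boundary_eq x₀ hx₀, hw0 x₀ hxr]
    · exact hball.mono fun t ht => hle _ (subset_closure ht)

lemma mem_exteriorTouchingRadii_of_lt {r : ℝ} (hr : 0 < r)
    (h : ENNReal.ofReal r < optimalExteriorRadius Ω) : r ∈ exteriorTouchingRadii Ω := by
  obtain ⟨r', h1⟩ := lt_iSup_iff.1 h
  obtain ⟨h2, h3⟩ := lt_iSup_iff.1 h1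
  have hle : r ≤ r' := (ENNReal.ofReal_lt_ofReal_iff'.1 h3).1.le
  exact ⟨hr, fun x hx => exists_touching_ball_of_le hr hle (h2.2 x hx)⟩

/-- With `t = 1/r`, the expression is `1/N` times the difference quotient of `(1 + d t)^N` at `0`.
-/
lemma tendsto_annulusConstant_atTop {N : ℕ} (hN : 0 < N) (d : ℝ) :
    Tendsto (fun r : ℝ => (d + r) ^ N / (N * r ^ (N - 1)) - r / N) atTop (𝓝 d) := by
  have hN' : (0 : ℝ) < N := by exact_mod_cast hN
  have h1 : HasDerivAt (fun t : ℝ => (1 + d * t) ^ N) (N * d) 0 := by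
    have := (((hasDerivAt_id (0 : ℝ)).const_mul d).const_add 1).pow N
    simpa [Pi.pow_def] using this
  have h2 : Tendsto (slope (fun t : ℝ => (1 + d * t) ^ N) 0) (𝓝[>] 0) (𝓝 (N * d)) :=
    (hasDerivAt_iff_tendsto_slope.1 h1).mono_left
      (nhdsWithin_mono _ fun t (ht : 0 < t) => ht.ne')
  have h3 := (h2.comp tendsto_inv_atTop_nhdsGT_zero).div_const (N : ℝ)
  rw [mul_div_cancel_left₀ _ hN'.ne'] at h3
  refine h3.congr' ?_
  filter_upwards [eventually_gt_atTop 0] with r hr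
  obtain ⟨m, rfl⟩ := Nat.exists_eq_succ_of_ne_zero hN.ne'
  have e1 : (1 + d * r⁻¹) = (d + r) / r := by
    field_simp
    ring
  simp only [Function.comp, slope_def_field, Nat.succ_eq_add_one, Nat.add_sub_cancel, e1,
    mul_zero, add_zero, one_pow, sub_zero, div_pow]
  field_simp
  ring

/-- An estimate by all exterior radii passes to the optimal one. -/
lemma le_annulusConstant_optimal (hN : 0 < N) {d g : ℝ}
    (hpos : 0 < optimalExteriorRadius Ω)
    (h : ∀ r ∈ exteriorTouchingRadii Ω, g ≤ (d + r) ^ N / (N * r ^ (N - 1)) - r / N) :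
    g ≤ annulusConstant N d (optimalExteriorRadius Ω) := by
  have hN' : (0 : ℝ) < N := by exact_mod_cast hN
  rw [annulusConstant]
  split_ifs with htop
  · refine ge_of_tendsto (tendsto_annulusConstant_atTop hN d) ?_
    filter_upwards [eventually_gt_atTop 0] with r hr
    exact h r (mem_exteriorTouchingRadii_of_lt hr (htop ▸ ENNReal.ofReal_lt_top))
  · set ρ := (optimalExteriorRadius Ω).toReal
    have hρ : 0 < ρ := ENNReal.toReal_pos hpos.ne' htop
    have hc : ContinuousAt (fun r : ℝ => (d + r) ^ N / (N * r ^ (N - 1)) - r / N) ρ := by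
      refine ContinuousAt.sub (ContinuousAt.div (by fun_prop) (by fun_prop) ?_) (by fun_prop)
      positivity
    -- Only radii below the supremum are known to be admissible, hence the limit from the left.
    refine ge_of_tendsto (hc.tendsto.mono_left (nhdsWithin_le_nhds (s := Iio ρ))) ?_
    filter_upwards [self_mem_nhdsWithin, nhdsWithin_le_nhds (Ioi_mem_nhds hρ)] with r h1 h2
    exact h r (mem_exteriorTouchingRadii_of_lt h2
      ((ENNReal.ofReal_lt_iff_lt_toReal (le_of_lt h2) htop).2 h1))

end Torsion
end

theorem proposition3p5 {N : ℕ} (hN : 2 ≤ N) {p : ℝ} (hp : 1 < p)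
    {Ω : Set (EuclideanSpace ℝ (Fin N))} (hΩ : IsBoundedC2Domain Ω)
    {u : EuclideanSpace ℝ (Fin N) → ℝ} (hu : IsC1UpToBoundary Ω u)
    (hsol : SolvesPTorsion p Ω u) :
    0 < optimalInteriorRadius Ω ∧ 0 < optimalExteriorRadius Ω ∧
    ∀ x ∈ frontier Ω,
      (optimalInteriorRadius Ω / N) ^ (1 / (p - 1)) ≤ ‖closureGradient Ω u x‖ ∧
      ‖closureGradient Ω u x‖ ≤
        annulusConstant N (Metric.diam Ω) (optimalExteriorRadius Ω) ^ (1 / (p - 1)) := by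
  have hN0 : 0 < N := by omega
  have hN' : (0 : ℝ) < N := by exact_mod_cast hN0
  have hp' : 0 < p - 1 := by linarith
  obtain ⟨ri, hri⟩ := hΩ.nonempty_interiorTouchingRadii
  obtain ⟨re, hre⟩ := hΩ.nonempty_exteriorTouchingRadii
  -- `sSup` of a nonempty set of reals unbounded above is `0`, so positivity also encodes `ρ_i < ∞`.
  have hi : 0 < optimalInteriorRadius Ω :=
    hri.1.trans_le (le_csSup (hΩ.bddAbove_interiorTouchingRadii hN0) hri)
  have he : 0 < optimalExteriorRadius Ω :=
    (ENNReal.ofReal_pos.2 hre.1).trans_le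
      (le_iSup₂ (f := fun r (_ : r ∈ exteriorTouchingRadii Ω) => ENNReal.ofReal r) re hre)
  refine ⟨hi, he, fun x hx => ?_⟩
  set g := ‖closureGradient Ω u x‖
  have hg0 : 0 ≤ g := norm_nonneg _
  have hinv : ∀ {s t : ℝ}, 0 ≤ s → 0 ≤ t → (s ≤ t ^ (1 / (p - 1)) ↔ s ^ (p - 1) ≤ t) :=
    fun {s t} hs ht => by
      rw [one_div, Real.le_rpow_inv_iff_of_pos hs ht hp']
  constructor
  · rw [one_div, Real.rpow_inv_le_iff_of_pos (by positivity) hg0 hp', div_le_iff₀ hN']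
    refine csSup_le ⟨ri, hri⟩ fun r hr => ?_
    have h1 := hsol.lower_bound hN0 hp hΩ hu hx hr
    have hr0 := hr.1
    rwa [one_div, Real.rpow_inv_le_iff_of_pos (by positivity) hg0 hp', div_le_iff₀ hN'] at h1
  · have hle : g ^ (p - 1) ≤ annulusConstant N (Metric.diam Ω) (optimalExteriorRadius Ω) := by
      refine le_annulusConstant_optimal hN0 he fun r hr => ?_
      have h1 := hsol.upper_bound hN0 hp hΩ hu hx hr
      have hr0 := hr.1
      refine (hinv hg0 ?_).1 h1
      -- Inverting the power requires a nonnegative bracket; this holds since `r / N` is its first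
      -- term with `diam Ω` replaced by `0`.
      have h2 : r ^ N ≤ (Metric.diam Ω + r) ^ N :=
        pow_le_pow_left₀ hr0.le (by linarith [Metric.diam_nonneg (s := Ω)]) N
      have h3 : r / N = r ^ N / (N * r ^ (N - 1)) := by
        obtain ⟨m, rfl⟩ := Nat.exists_eq_succ_of_ne_zero hN0.ne'
        simp only [Nat.succ_eq_add_one, Nat.add_sub_cancel]
        field_simp
        ring
      rw [h3, sub_nonneg]
      gcongr
    exact (hinv hg0 ((Real.rpow_nonneg hg0 _).trans hle)).2 hle
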